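/- Let $W\in(0,\tfrac12)$, let $N\ge 1$ be an integer, and put $c=\pi N W$. Let $\widetilde Q_{W,N}$ be the (positive, finite rank) operator on $L^2(-W,W)$ given by $$\widetilde Q_{W,N}f(x)=\int_{-W}^{W}\frac{\sin(N\pi(x-y))}{\sin(\pi(x-y))}f(y)\,dy ,$$ and let $\mathcal Q_c$ be the (positive, compact) operator on $L^2(-1,1)$ given by $$\mathcal Q_cf(x)=\int_{-1}^{1}\frac{\sin(c(x-y))}{\pi(x-y)}f(y)\,dy .$$ Let $\widetilde\lambda_{0,N}(W)\ge\cdots\ge\widetilde\lambda_{N-1,N}(W)$ be the first $N$ eigenvalues of $\widetilde Q_{W,N}$ and $\lambda_0(c)\ge\lambda_1(c)\ge\cdots$ those of $\mathcal Q_c$, in each case the positive eigenvalues in decreasing order, repeated according to multiplicity (and followed by zeros if they are exhausted); set $\widetilde\lambda_{k,N}(W)=0$ for $k\ge N$. Then the series below converges and $$\left(\sum_{k=0}^{\infty}\left|\widetilde\lambda_{k,N}(W)-\lambda_k(c)\right|^2\right)^{1/2}\le W^3\,\frac{4\pi^2}{3\sin(2\pi W)} .$$ -/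

import Mathlib

open MeasureTheory

noncomputable section

namespace Prolate

/-- For a bounded measurable kernel, `x ↦ ∫ K(x,y) f(y) dμ(y)` is in `L²(μ)` when `f` is and `μ` is
a finite measure. -/
theorem memLp_kernel (μ : Measure ℝ) [IsFiniteMeasure μ] (K : ℝ → ℝ → ℝ)
    (hK : Measurable (Function.uncurry K)) (C : ℝ) (hC : ∀ x y, |K x y| ≤ C)
    (f : Lp ℂ 2 μ) : MemLp (fun x => ∫ y, (K x y : ℂ) * f y ∂μ) 2 μ := by
  have hf : Integrable (fun y => f y) μ := (Lp.memLp f).integrable (by norm_num)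
  refine MemLp.of_bound ?_ (∫ y, C * ‖f y‖ ∂μ) (Filter.Eventually.of_forall fun x => ?_)
  · have h : AEStronglyMeasurable (fun p : ℝ × ℝ => (K p.1 p.2 : ℂ) * f p.2) (μ.prod μ) := by
      refine AEStronglyMeasurable.mul ?_ ?_
      · exact (Complex.measurable_ofReal.comp hK).aestronglyMeasurable
      · exact (Lp.aestronglyMeasurable f).comp_snd
    exact h.integral_prod_right'
  · refine norm_integral_le_of_norm_le (hf.norm.const_mul C) (Filter.Eventually.of_forall fun y => ?_)
    rw [norm_mul, Complex.norm_real, Real.norm_eq_abs]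
    exact mul_le_mul_of_nonneg_right (hC x y) (norm_nonneg _)

theorem integrable_kernel (μ : Measure ℝ) [IsFiniteMeasure μ] (K : ℝ → ℝ → ℝ)
    (hK : Measurable (Function.uncurry K)) (C : ℝ) (hC : ∀ x y, |K x y| ≤ C)
    (f : Lp ℂ 2 μ) (x : ℝ) : Integrable (fun y => (K x y : ℂ) * f y) μ := by
  have hf : Integrable (fun y => f y) μ := (Lp.memLp f).integrable (by norm_num)
  refine hf.bdd_mul (c := C) ?_ (Filter.Eventually.of_forall fun y => ?_)
  · exact (Complex.measurable_ofReal.comp (hK.comp measurable_prodMk_left)).aestronglyMeasurable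
  · rw [Complex.norm_real, Real.norm_eq_abs]; exact hC x y

/-- The integral operator `f ↦ (x ↦ ∫ K(x,y) f(y) dμ(y))` on the complex Hilbert space `L²(μ)`. -/
def kernelOp (μ : Measure ℝ) [IsFiniteMeasure μ] (K : ℝ → ℝ → ℝ)
    (hK : Measurable (Function.uncurry K)) (C : ℝ) (hC : ∀ x y, |K x y| ≤ C) :
    Lp ℂ 2 μ →ₗ[ℂ] Lp ℂ 2 μ where
  toFun f := (memLp_kernel μ K hK C hC f).toLp _
  map_add' f g := by
    rw [← MemLp.toLp_add, MemLp.toLp_eq_toLp_iff]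
    refine Filter.Eventually.of_forall fun x => ?_
    simp only [Pi.add_apply]
    rw [← integral_add (integrable_kernel μ K hK C hC f x) (integrable_kernel μ K hK C hC g x)]
    refine integral_congr_ae ?_
    filter_upwards [Lp.coeFn_add f g] with y hy
    simp only [hy, Pi.add_apply, mul_add]
  map_smul' a f := by
    rw [RingHom.id_apply, ← MemLp.toLp_const_smul, MemLp.toLp_eq_toLp_iff]
    refine Filter.Eventually.of_forall fun x => ?_
    simp only [Pi.smul_apply, smul_eq_mul]
    rw [← integral_const_mul]
    refine integral_congr_ae ?_
    filter_upwards [Lp.coeFn_smul a f] with y hy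
    simp only [hy, Pi.smul_apply, smul_eq_mul]
    ring

/-- The Dirichlet kernel `sin(Nπ(x-y)) / sin(π(x-y))`. (On the null set where the denominator
vanishes its value is `0`; this does not affect the integral operator.) -/
def dirichletKernel (N : ℕ) (x y : ℝ) : ℝ :=
  Real.sin (N * Real.pi * (x - y)) / Real.sin (Real.pi * (x - y))

/-- The sinc kernel `sin(c(x-y)) / (π(x-y))`. (On the null set `x = y` its value is `0`; this does
not affect the integral operator.) -/
def sincKernel (c : ℝ) (x y : ℝ) : ℝ :=
  Real.sin (c * (x - y)) / (Real.pi * (x - y))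

theorem measurable_dirichletKernel (N : ℕ) :
    Measurable (Function.uncurry (dirichletKernel N)) := by
  unfold dirichletKernel Function.uncurry
  fun_prop

theorem measurable_sincKernel (c : ℝ) : Measurable (Function.uncurry (sincKernel c)) := by
  unfold sincKernel Function.uncurry
  fun_prop

theorem abs_sin_nat_mul_le (n : ℕ) (t : ℝ) : |Real.sin (n * t)| ≤ n * |Real.sin t| := by
  induction n with
  | zero => simp
  | succ n ih =>
    have h : ((n + 1 : ℕ) : ℝ) * t = n * t + t := by push_cast; ring
    rw [h, Real.sin_add]
    refine (abs_add_le _ _).trans ?_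
    rw [abs_mul, abs_mul]
    have h1 := Real.abs_cos_le_one t
    have h2 := Real.abs_cos_le_one (n * t)
    have h3 := mul_le_of_le_one_right (abs_nonneg (Real.sin (n * t))) h1
    have h4 := mul_le_of_le_one_left (abs_nonneg (Real.sin t)) h2
    push_cast
    linarith

theorem abs_dirichletKernel_le (N : ℕ) (x y : ℝ) : |dirichletKernel N x y| ≤ N := by
  unfold dirichletKernel
  rw [abs_div, mul_assoc]
  exact div_le_of_le_mul₀ (abs_nonneg _) (Nat.cast_nonneg N) (abs_sin_nat_mul_le N _)

theorem abs_sincKernel_le (c x y : ℝ) : |sincKernel c x y| ≤ |c| / Real.pi := by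
  unfold sincKernel
  rw [abs_div]
  refine div_le_of_le_mul₀ (abs_nonneg _) (by positivity) ?_
  refine (Real.abs_sin_le_abs).trans ?_
  rw [abs_mul, abs_mul, abs_of_pos Real.pi_pos]
  apply le_of_eq
  field_simp

/-- The operator `Q̃_{W,N} f (x) = ∫_{-W}^{W} sin(Nπ(x-y)) / sin(π(x-y)) f(y) dy` on `L²(-W,W)`. -/
def QTilde (W : ℝ) (N : ℕ) :
    Lp ℂ 2 (volume.restrict (Set.Ioo (-W) W)) →ₗ[ℂ] Lp ℂ 2 (volume.restrict (Set.Ioo (-W) W)) :=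
  kernelOp _ (dirichletKernel N) (measurable_dirichletKernel N) N (abs_dirichletKernel_le N)

/-- The sinc-kernel operator `Q_c f (x) = ∫_{-1}^{1} sin(c(x-y)) / (π(x-y)) f(y) dy` on
`L²(-1,1)`. -/
def QSinc (c : ℝ) :
    Lp ℂ 2 (volume.restrict (Set.Ioo (-1 : ℝ) 1)) →ₗ[ℂ]
      Lp ℂ 2 (volume.restrict (Set.Ioo (-1 : ℝ) 1)) :=
  kernelOp _ (sincKernel c) (measurable_sincKernel c) (|c| / Real.pi) (abs_sincKernel_le c)

/-- The span of all eigenvectors of `T` whose eigenvalue is real and `> r`. Eigenspaces being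
linearly independent, its dimension is the number of eigenvalues `> r`, counted with multiplicity. -/
def eigenspaceAbove {H : Type*} [AddCommGroup H] [Module ℂ H] (T : H →ₗ[ℂ] H) (r : ℝ) :
    Submodule ℂ H :=
  ⨆ μ : {μ : ℝ // r < μ}, Module.End.eigenspace T ((μ : ℝ) : ℂ)

/-- The positive eigenvalues `λ₀ ≥ λ₁ ≥ ⋯` of `T`, arranged in decreasing order, repeated according
to multiplicity, and followed by zeros once they are exhausted (for a positive compact operator
`T`): `λ_k` is the least `r ≥ 0` such that at most `k` eigenvalues, counted with multiplicity,
exceed `r`. -/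
def eigenvalueSeq {H : Type*} [AddCommGroup H] [Module ℂ H] (T : H →ₗ[ℂ] H) (k : ℕ) : ℝ :=
  sInf {r : ℝ | 0 ≤ r ∧ Module.rank ℂ (eigenspaceAbove T r) ≤ (k : Cardinal)}

/-- `λ̃_{k,N}(W)`: the eigenvalues of `Q̃_{W,N}` for `k < N`, and `0` for `k ≥ N`. -/
def lambdaTilde (W : ℝ) (N : ℕ) (k : ℕ) : ℝ :=
  if k < N then eigenvalueSeq (QTilde W N) k else 0

/-- `λ_k(c)`: the eigenvalues of `Q_c`. -/
def lambdaSinc (c : ℝ) (k : ℕ) : ℝ :=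
  eigenvalueSeq (QSinc c) k

end Prolate

end

/-!
Substituting `x ↦ W x` turns `QSinc (π N W)` on `L²(-1, 1)` into the operator on `L²(-W, W)` with
kernel `sin(Nπ(x - y)) / (π(x - y))`, without changing its eigenvalues
(`eigenvalueSeq_kernelOp_sincKernel`). That operator and `QTilde W N` then act on the same space,
and their kernels differ by `sin(N u) (1 / sin u - 1 / u)` with `u = π(x - y)`, which is at most
`2π²W² / (3 sin 2πW)` in absolute value (`abs_dirichletKernel_sub_sincKernel_le`). Integrating the
square over `(-W, W)²` bounds the Hilbert–Schmidt norm of the difference by the right-hand side of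
the theorem.

It remains to compare eigenvalues with the Hilbert–Schmidt norm, which is the Hoffman–Wielandt
inequality for positive Hilbert–Schmidt operators (`tsum_sq_sub_eigenvalueSeq_le`). If `T` and `S`
have eigenbases `e`, `f` with eigenvalues `a`, `b`, then
`‖T - S‖² = ∑ᵢⱼ pᵢⱼ (aᵢ - bⱼ)²` with the doubly stochastic matrix `pᵢⱼ = |⟪fⱼ, eᵢ⟫|²`. The sums of
squares do not depend on `p`, and the mixed sum `∑ᵢⱼ pᵢⱼ aᵢ bⱼ` is at most the one for the
decreasing rearrangements, by a layer-cake argument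
(`IsDecreasingRearrangement.tsum_mul_le`). Working in `ℝ≥0∞` removes all summability questions.

Both operators are positive because both kernels are Fourier transforms of positive measures,
evaluated at `x - y` (`isPositive_kernelOp`). The cut-off of the eigenvalues of `QTilde W N` at
`k = N` is harmless since this operator has rank at most `N` (`rank_range_QTilde_le`).
-/

namespace Prolate

/-! ### Decreasing rearrangements and the layer-cake formula -/

section Rearrangement

open scoped ENNReal
open Set

/-- `l` is the decreasing rearrangement of the nonnegative family `a`: above every positive level
`s` the family `a` has only finitely many members, and the terms of `l` exceeding `s` are exactly
the first so many. -/
def IsDecreasingRearrangement {ι : Type*} (a : ι → ℝ) (l : ℕ → ℝ) : Prop :=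
  ∀ s : ℝ, 0 < s → ∃ m : ℕ, {i | s < a i}.encard = m ∧ ∀ k, s < l k ↔ k < m

theorem lintegral_Ioi_indicator_Iio (a : ℝ) :
    ∫⁻ s in Ioi (0 : ℝ), (Iio a).indicator 1 s = ENNReal.ofReal a := by
  rw [lintegral_indicator_one measurableSet_Iio, Measure.restrict_apply measurableSet_Iio,
    Iio_inter_Ioi, Real.volume_Ioo, sub_zero]

/-- Layer-cake formula for a weighted sum of products. -/
theorem tsum_mul_ofReal_mul_ofReal {κ : Type*} [Countable κ] (w : κ → ℝ≥0∞) (a b : κ → ℝ) :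
    ∑' k, w k * (ENNReal.ofReal (a k) * ENNReal.ofReal (b k)) =
      ∫⁻ s in Ioi (0 : ℝ), ∫⁻ t in Ioi (0 : ℝ),
        ∑' k, w k * ((Iio (a k)).indicator 1 s * (Iio (b k)).indicator 1 t) := by
  have hm (c : ℝ) : Measurable ((Iio c).indicator (1 : ℝ → ℝ≥0∞)) :=
    measurable_one.indicator measurableSet_Iio
  have h1 (s : ℝ) : ∫⁻ t in Ioi (0 : ℝ),
      ∑' k, w k * ((Iio (a k)).indicator 1 s * (Iio (b k)).indicator 1 t) =
      ∑' k, w k * ((Iio (a k)).indicator 1 s * ENNReal.ofReal (b k)) := by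
    rw [lintegral_tsum fun k => (((hm _).const_mul _).const_mul _).aemeasurable]
    refine tsum_congr fun k => ?_
    rw [lintegral_const_mul _ ((hm _).const_mul _), lintegral_const_mul _ (hm _),
      lintegral_Ioi_indicator_Iio]
  simp_rw [h1]
  rw [lintegral_tsum fun k => (((hm _).mul_const _).const_mul _).aemeasurable]
  refine tsum_congr fun k => ?_
  rw [lintegral_const_mul _ ((hm _).mul_const _), lintegral_mul_const _ (hm _),
    lintegral_Ioi_indicator_Iio]

theorem tsum_indicator_Iio {ι : Type*} (a : ι → ℝ) (s : ℝ) :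
    ∑' i, (Iio (a i)).indicator (1 : ℝ → ℝ≥0∞) s = {i | s < a i}.encard := by
  rw [← ENNReal.tsum_set_one, tsum_subtype {i | s < a i} (fun _ => (1 : ℝ≥0∞))]
  rfl

theorem indicator_Iio_mul_indicator_Iio (a s t : ℝ) :
    (Iio a).indicator (1 : ℝ → ℝ≥0∞) s * (Iio a).indicator 1 t =
      (Iio a).indicator 1 (max s t) := by
  by_cases hs : s < a <;> by_cases ht : t < a <;> simp [indicator, hs, ht]

theorem tsum_ofReal_sq {ι : Type*} [Countable ι] (a : ι → ℝ) :
    ∑' i, ENNReal.ofReal (a i) ^ 2 =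
      ∫⁻ s in Ioi (0 : ℝ), ∫⁻ t in Ioi (0 : ℝ), ∑' i, (Iio (a i)).indicator 1 (max s t) := by
  simpa only [one_mul, ← sq, indicator_Iio_mul_indicator_Iio] using
    tsum_mul_ofReal_mul_ofReal (fun _ => 1) a a

namespace IsDecreasingRearrangement

variable {ι κ : Type*} {a : ι → ℝ} {b : κ → ℝ} {l l' : ℕ → ℝ}

theorem tsum_indicator_eq (h : IsDecreasingRearrangement a l) {s : ℝ} (hs : 0 < s) :
    ∑' i, (Iio (a i)).indicator (1 : ℝ → ℝ≥0∞) s = ∑' k, (Iio (l k)).indicator 1 s := by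
  obtain ⟨m, hm, hl⟩ := h s hs
  rw [tsum_indicator_Iio, tsum_indicator_Iio, hm]
  congr 1
  have : {k | s < l k} = (Finset.range m : Set ℕ) := by ext k; simp [hl]
  rw [this, encard_coe_eq_coe_finsetCard, Finset.card_range]

/-- A family and its decreasing rearrangement have the same sum of squares. -/
theorem tsum_sq_eq [Countable ι] (h : IsDecreasingRearrangement a l) :
    ∑' i, ENNReal.ofReal (a i) ^ 2 = ∑' k, ENNReal.ofReal (l k) ^ 2 := by
  rw [tsum_ofReal_sq, tsum_ofReal_sq]
  refine setLIntegral_congr_fun measurableSet_Ioi fun s hs => ?_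
  refine setLIntegral_congr_fun measurableSet_Ioi fun t _ => ?_
  exact h.tsum_indicator_eq (lt_max_of_lt_left hs)

/-- Rearrangement inequality: if the weights `p` are doubly substochastic, then pairing two
nonnegative families through `p` gives at most the sum of products of the two decreasing
rearrangements. Level by level, `p` gives the rectangle `{a > s} × {b > t}` at most the mass
`min #{a > s} #{b > t}`, which is the number of `k` with `l k > s` and `l' k > t`. -/
theorem tsum_mul_le [Countable ι] [Countable κ] (h : IsDecreasingRearrangement a l)
    (h' : IsDecreasingRearrangement b l') (p : ι → κ → ℝ≥0∞) (hrow : ∀ i, ∑' j, p i j ≤ 1)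
    (hcol : ∀ j, ∑' i, p i j ≤ 1) :
    ∑' i, ∑' j, p i j * (ENNReal.ofReal (a i) * ENNReal.ofReal (b j)) ≤
      ∑' k, ENNReal.ofReal (l k) * ENNReal.ofReal (l' k) := by
  have h1 := tsum_mul_ofReal_mul_ofReal (fun q : ι × κ => p q.1 q.2) (fun q => a q.1)
    (fun q => b q.2)
  have h2 := tsum_mul_ofReal_mul_ofReal (fun _ : ℕ => 1) l l'
  simp only [one_mul] at h2
  rw [← ENNReal.tsum_prod (f := fun i j => p i j * (ENNReal.ofReal (a i) * ENNReal.ofReal (b j))),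
    h1, h2]
  refine setLIntegral_mono' measurableSet_Ioi fun s hs => ?_
  refine setLIntegral_mono' measurableSet_Ioi fun t ht => ?_
  obtain ⟨m, hm, hl⟩ := h s hs
  obtain ⟨n, hn, hl'⟩ := h' t ht
  have ind_le (c u : ℝ) : (Iio c).indicator (1 : ℝ → ℝ≥0∞) u ≤ 1 := indicator_le_self' (by simp) u
  have hR : ∑' k, (Iio (l k)).indicator (1 : ℝ → ℝ≥0∞) s * (Iio (l' k)).indicator 1 t =
      ((min m n : ℕ) : ℝ≥0∞) := by
    have : ∀ k, (Iio (l k)).indicator (1 : ℝ → ℝ≥0∞) s * (Iio (l' k)).indicator 1 t =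
        if k ∈ Finset.range (min m n) then 1 else 0 := by
      intro k
      by_cases h1 : k < m <;> by_cases h2 : k < n <;> simp [indicator, hl, hl', h1, h2]
    simp_rw [this]
    rw [tsum_eq_sum (s := Finset.range (min m n)) (fun k hk => if_neg hk), Finset.sum_ite_mem,
      Finset.inter_self]
    simp
  rw [hR, (Nat.mono_cast (α := ℝ≥0∞)).map_min, le_min_iff,
    ENNReal.tsum_prod (f := fun i j => p i j *
      ((Iio (a i)).indicator (1 : ℝ → ℝ≥0∞) s * (Iio (b j)).indicator 1 t))]
  constructor
  · calc ∑' i, ∑' j, p i j * ((Iio (a i)).indicator (1 : ℝ → ℝ≥0∞) s * (Iio (b j)).indicator 1 t)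
        ≤ ∑' i, ∑' j, p i j * (Iio (a i)).indicator (1 : ℝ → ℝ≥0∞) s :=
          ENNReal.tsum_le_tsum fun i => ENNReal.tsum_le_tsum fun j =>
            mul_le_mul_right (mul_le_of_le_one_right' (ind_le _ _)) _
      _ ≤ ∑' i, (Iio (a i)).indicator (1 : ℝ → ℝ≥0∞) s :=
          ENNReal.tsum_le_tsum fun i =>
            ENNReal.tsum_mul_right.trans_le (mul_le_of_le_one_left' (hrow i))
      _ = m := by rw [tsum_indicator_Iio, hm]; simp
  · rw [ENNReal.tsum_comm]
    calc ∑' j, ∑' i, p i j * ((Iio (a i)).indicator (1 : ℝ → ℝ≥0∞) s * (Iio (b j)).indicator 1 t)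
        ≤ ∑' j, ∑' i, p i j * (Iio (b j)).indicator (1 : ℝ → ℝ≥0∞) t :=
          ENNReal.tsum_le_tsum fun j => ENNReal.tsum_le_tsum fun i =>
            mul_le_mul_right (mul_le_of_le_one_left' (ind_le _ _)) _
      _ ≤ ∑' j, (Iio (b j)).indicator (1 : ℝ → ℝ≥0∞) t :=
          ENNReal.tsum_le_tsum fun j =>
            ENNReal.tsum_mul_right.trans_le (mul_le_of_le_one_left' (hcol j))
      _ = n := by rw [tsum_indicator_Iio, hn]; simp

end IsDecreasingRearrangement

end Rearrangement

/-! ### Hilbert–Schmidt operators and their eigenbases -/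

section HilbertSchmidt

universe u

variable {H : Type u} [NormedAddCommGroup H] [InnerProductSpace ℂ H]

/-- The squared Hilbert–Schmidt norm of `T` is at most `D`, expressed through the finite partial
sums `∑ ‖T eᵢ‖²` over orthonormal families, so that no basis has to be chosen. -/
def HilbertSchmidtSqLE (T : H →ₗ[ℂ] H) (D : ℝ) : Prop :=
  ∀ (ι : Type u) (e : ι → H), Orthonormal ℂ e → ∀ F : Finset ι, ∑ i ∈ F, ‖T (e i)‖ ^ 2 ≤ D

theorem HilbertSchmidtSqLE.summable {T : H →ₗ[ℂ] H} {D : ℝ} (h : HilbertSchmidtSqLE T D)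
    {ι : Type u} {e : ι → H} (he : Orthonormal ℂ e) : Summable fun i => ‖T (e i)‖ ^ 2 :=
  summable_of_sum_le (fun _ => by positivity) (h ι e he)

theorem HilbertSchmidtSqLE.tsum_ofReal_le {T : H →ₗ[ℂ] H} {D : ℝ} (h : HilbertSchmidtSqLE T D)
    {ι : Type u} {e : ι → H} (he : Orthonormal ℂ e) :
    ∑' i, ENNReal.ofReal (‖T (e i)‖ ^ 2) ≤ ENNReal.ofReal D := by
  rw [← ENNReal.ofReal_tsum_of_nonneg (fun _ => by positivity) (h.summable he)]
  exact ENNReal.ofReal_le_ofReal ((h.summable he).tsum_le_of_sum_le (h ι e he))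

/-- In a separable Hilbert space, orthonormal families are countable: the balls of radius `1/2`
around their members are disjoint. -/
theorem countable_of_orthonormal [TopologicalSpace.SeparableSpace H] {ι : Type*} {e : ι → H}
    (he : Orthonormal ℂ e) : Countable ι := by
  have hd : (Set.univ : Set ι).PairwiseDisjoint fun i => Metric.ball (e i) (1 / 2) := by
    intro i _ j _ hij
    refine Metric.ball_disjoint_ball ?_
    have h2 : ‖e i - e j‖ ^ 2 = 2 := by
      rw [@norm_sub_sq ℂ, he.1 i, he.1 j, he.2 hij]
      norm_num
    rw [dist_eq_norm]
    nlinarith [norm_nonneg (e i - e j)]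
  exact Set.countable_univ_iff.mp
    (hd.countable_of_isOpen (fun _ _ => Metric.isOpen_ball)
      fun i _ => ⟨e i, Metric.mem_ball_self (by norm_num)⟩)

/-- A continuous Hilbert–Schmidt operator is compact: it is the norm limit of its restrictions
to the spans of finitely many members of a Hilbert basis. -/
theorem HilbertSchmidtSqLE.isCompactOperator [CompleteSpace H] {T : H →L[ℂ] H} {D : ℝ}
    (h : HilbertSchmidtSqLE (T : H →ₗ[ℂ] H) D) : IsCompactOperator T := by
  classical
  obtain ⟨w, b, -⟩ := exists_hilbertBasis ℂ H
  have hb := b.orthonormal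
  let R : Finset w → H →L[ℂ] H := fun F => ∑ i ∈ F, (innerSL ℂ (b i)).smulRight (T (b i))
  have hR (F : Finset w) : IsCompactOperator (R F) := by
    refine Submodule.sum_mem (compactOperator (RingHom.id ℂ) H H) fun i _ => ?_
    have : ⇑((innerSL ℂ (b i)).smulRight (T (b i))) =
        ⇑(ContinuousLinearMap.toSpanSingleton ℂ (T (b i))) ∘ ⇑(innerSL ℂ (b i)) := by
      ext x; simp
    change IsCompactOperator ⇑((innerSL ℂ (b i)).smulRight (T (b i)))
    rw [this]
    exact (isCompactOperator_of_locallyCompactSpace_rng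
      (ContinuousLinearMap.toSpanSingleton ℂ (T (b i)))).comp_clm (innerSL ℂ (b i))
  refine isCompactOperator_of_tendsto (l := Filter.atTop) (F := R) ?_ (Filter.Eventually.of_forall hR)
  rw [Metric.tendsto_atTop]
  intro ε hε
  obtain ⟨F₀, hF₀⟩ := summable_iff_vanishing_norm.mp (h.summable hb) ((ε / 2) ^ 2) (by positivity)
  refine ⟨F₀, fun F hF => ?_⟩
  rw [dist_comm, dist_eq_norm]
  refine lt_of_le_of_lt (ContinuousLinearMap.opNorm_le_bound _ (half_pos hε).le fun x => ?_)
    (half_lt_self hε)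
  have hs : HasSum (fun i => inner ℂ (b i) x • T (b i)) (T x) := by
    simpa [b.repr_apply_apply] using (b.hasSum_repr x).mapL T
  have hlim : Filter.Tendsto (fun G : Finset w => ‖∑ i ∈ G, inner ℂ (b i) x • T (b i) - R F x‖)
      Filter.atTop (nhds ‖(T - R F) x‖) := (hs.sub_const _).norm
  refine le_of_tendsto hlim (Filter.eventually_atTop.mpr ⟨F, fun G hG => ?_⟩)
  have hRF : R F x = ∑ i ∈ F, inner ℂ (b i) x • T (b i) := by simp [R]
  rw [hRF, ← Finset.sum_sdiff_eq_sub hG]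
  have hx : ∑ i ∈ G \ F, ‖inner ℂ (b i) x‖ ^ 2 ≤ ‖x‖ ^ 2 := hb.sum_inner_products_le x
  have hT : ∑ i ∈ G \ F, ‖T (b i)‖ ^ 2 ≤ (ε / 2) ^ 2 := by
    have := hF₀ (G \ F) (Finset.sdiff_disjoint.mono_right hF)
    rw [Real.norm_of_nonneg (Finset.sum_nonneg fun _ _ => by positivity)] at this
    exact this.le
  refine abs_le_of_sq_le_sq' ?_ (by positivity) |>.2
  calc ‖∑ i ∈ G \ F, inner ℂ (b i) x • T (b i)‖ ^ 2
      ≤ (∑ i ∈ G \ F, ‖inner ℂ (b i) x‖ * ‖T (b i)‖) ^ 2 := by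
        gcongr
        exact norm_sum_le_of_le _ fun i _ => (norm_smul _ _).le
    _ ≤ (∑ i ∈ G \ F, ‖inner ℂ (b i) x‖ ^ 2) * ∑ i ∈ G \ F, ‖T (b i)‖ ^ 2 :=
        Finset.sum_mul_sq_le_sq_mul_sq _ _ _
    _ ≤ ‖x‖ ^ 2 * (ε / 2) ^ 2 := by
        gcongr
    _ = (ε / 2 * ‖x‖) ^ 2 := by ring

open scoped ComplexOrder in
/-- A positive compact operator has a Hilbert basis of eigenvectors. -/
theorem exists_eigenbasis [CompleteSpace H] {T : H →ₗ[ℂ] H} (hT : T.IsPositive)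
    (hc : IsCompactOperator T) :
    ∃ (ι : Type u) (e : HilbertBasis ι ℂ H) (a : ι → ℝ), (∀ i, 0 ≤ a i) ∧
      ∀ i, T (e i) = (a i : ℂ) • e i := by
  let T' : H →L[ℂ] H := ⟨T, hT.isSymmetric.continuous⟩
  have hE (μ : ℂ) : IsClosed (Module.End.eigenspace T μ : Set H) := by
    have : (Module.End.eigenspace T μ : Set H) = {x | T x = μ • x} := by
      ext x; simp
    rw [this]
    exact isClosed_eq hT.isSymmetric.continuous (continuous_const_smul μ)
  have (μ : ℂ) : CompleteSpace (Module.End.eigenspace T μ) := (hE μ).completeSpace_coe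
  choose w b _ using fun μ : ℂ => exists_hilbertBasis ℂ (Module.End.eigenspace T μ)
  have ho : Orthonormal ℂ fun p : (Σ μ, w μ) => (b p.1 p.2 : H) :=
    hT.isSymmetric.orthogonalFamily_eigenspaces.orthonormal_sigma_orthonormal
      fun μ => (b μ).orthonormal
  have hsp : (Submodule.span ℂ (Set.range fun p : (Σ μ, w μ) => (b p.1 p.2 : H)))ᗮ = ⊥ := by
    rw [eq_bot_iff, ← ContinuousLinearMap.orthogonalComplement_iSup_eigenspaces_eq_bot
      (T := T') hc hT.isSymmetric]
    intro v hv
    rw [Submodule.mem_orthogonal] at hv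
    rw [← Submodule.iInf_orthogonal, Submodule.mem_iInf]
    intro μ
    rw [Submodule.mem_orthogonal]
    intro u hu
    have hs := ((b μ).hasSum_repr ⟨u, hu⟩).mapL (Module.End.eigenspace T μ).subtypeL
    have hs' := hs.mapL (innerSL ℂ v)
    have h0 : inner ℂ v u = 0 := by
      refine hs'.unique ?_
      convert! hasSum_zero using 2 with i
      have := hv _ (Submodule.subset_span ⟨⟨μ, i⟩, rfl⟩)
      simp [inner_eq_zero_symm.mp this]
    exact inner_eq_zero_symm.mp h0
  have hT_apply (p : Σ μ, w μ) : T (b p.1 p.2 : H) = p.1 • (b p.1 p.2 : H) :=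
    Module.End.mem_eigenspace_iff.mp (b p.1 p.2).2
  have hre (p : Σ μ, w μ) : 0 ≤ p.1 := by
    have h1 := hT.inner_nonneg_right (b p.1 p.2 : H)
    rwa [hT_apply, inner_smul_right, inner_self_eq_norm_sq_to_K, ho.1 p, RCLike.ofReal_one,
      one_pow, mul_one] at h1
  refine ⟨Σ μ, w μ, HilbertBasis.mkOfOrthogonalEqBot ho hsp, fun p => p.1.re,
    fun p => (Complex.nonneg_iff.mp (hre p)).1, fun p => ?_⟩
  rw [HilbertBasis.coe_mkOfOrthogonalEqBot, hT_apply]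
  congr 1
  exact Complex.ext rfl (Complex.nonneg_iff.mp (hre p)).2.symm

/-! ### Counting eigenvalues -/

theorem eigenspaceAbove_anti (T : H →ₗ[ℂ] H) {r s : ℝ} (h : r ≤ s) :
    eigenspaceAbove T s ≤ eigenspaceAbove T r :=
  iSup_le fun μ => le_iSup (fun μ : {μ : ℝ // r < μ} => Module.End.eigenspace T ((μ : ℝ) : ℂ))
    ⟨μ.1, h.trans_lt μ.2⟩

variable {ι : Type*} {T : H →ₗ[ℂ] H} (e : HilbertBasis ι ℂ H) {a : ι → ℝ}

theorem eigenspaceAbove_eq_span (hT : T.IsSymmetric) (ha : ∀ i, T (e i) = (a i : ℂ) • e i)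
    {s : ℝ} (hs : {i | s < a i}.Finite) :
    eigenspaceAbove T s = Submodule.span ℂ (e '' {i | s < a i}) := by
  apply le_antisymm
  · refine iSup_le fun μ v hv => ?_
    rw [Module.End.mem_eigenspace_iff] at hv
    -- `v` is orthogonal to the basis vectors with a different eigenvalue.
    have h0 (i : ι) (hi : i ∉ hs.toFinset) : (e.repr v i : ℂ) • e i = 0 := by
      have h1 : inner ℂ (T (e i)) v = inner ℂ (e i) (T v) := hT _ _
      rw [ha, hv, inner_smul_left, inner_smul_right, Complex.conj_ofReal] at h1
      have h2 : ((a i : ℂ) - ((μ : ℝ) : ℂ)) * inner ℂ (e i) v = 0 := by rw [sub_mul, h1, sub_self]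
      have h3 : (a i : ℂ) - ((μ : ℝ) : ℂ) ≠ 0 := by
        rw [← Complex.ofReal_sub, Complex.ofReal_ne_zero, sub_ne_zero]
        rintro h
        exact hi (by simpa [h] using μ.2)
      rw [e.repr_apply_apply, (mul_eq_zero.mp h2).resolve_left h3, zero_smul]
    rw [(e.hasSum_repr v).unique (hasSum_sum_of_ne_finset_zero h0)]
    refine Submodule.sum_mem _ fun i hi => Submodule.smul_mem _ _ (Submodule.subset_span ?_)
    exact ⟨i, by simpa using hi, rfl⟩
  · rw [Submodule.span_le]
    rintro _ ⟨i, hi, rfl⟩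
    exact Submodule.mem_iSup_of_mem (⟨a i, hi⟩ : {μ : ℝ // s < μ})
      (Module.End.mem_eigenspace_iff.mpr (ha i))

theorem rank_eigenspaceAbove (hT : T.IsSymmetric) (ha : ∀ i, T (e i) = (a i : ℂ) • e i)
    {s : ℝ} (hs : {i | s < a i}.Finite) :
    Module.rank ℂ (eigenspaceAbove T s) = ({i | s < a i}.ncard : Cardinal) := by
  have hli := e.orthonormal.linearIndependent
  rw [eigenspaceAbove_eq_span e hT ha hs, rank_span_set (hli.linearIndepOn_id.mono
    (Set.image_subset_range _ _)), ← Set.ncard_image_of_injective _ hli.injective,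
    Set.cast_ncard (hs.image e)]

/-- If the operator `T` is diagonalised by a Hilbert basis with eigenvalues `a` of which only
finitely many exceed any positive level, then `eigenvalueSeq T` is the decreasing rearrangement
of `a`. -/
theorem isDecreasingRearrangement_eigenvalueSeq (hT : T.IsSymmetric)
    (ha : ∀ i, T (e i) = (a i : ℂ) • e i) (hfin : ∀ s > 0, {i | s < a i}.Finite) :
    IsDecreasingRearrangement a (eigenvalueSeq T) := by
  intro s hs
  refine ⟨{i | s < a i}.ncard, ((hfin s hs).cast_ncard_eq).symm, fun k => ?_⟩
  have hbdd : BddBelow {r : ℝ | 0 ≤ r ∧ Module.rank ℂ (eigenspaceAbove T r) ≤ (k : Cardinal)} :=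
    ⟨0, fun _ hr => hr.1⟩
  rw [← not_iff_not, not_lt, not_lt]
  refine ⟨fun hle => ?_, fun hle => csInf_le hbdd ⟨hs.le, ?_⟩⟩
  · by_contra! hlt
    -- The finitely many eigenvalues above `s` all lie above some `r > s`.
    obtain ⟨r, hsr, hr⟩ : ∃ r, s < r ∧ ∀ i ∈ {i | s < a i}, r < a i := by
      have h1 : ∀ᶠ r in nhdsWithin s (Set.Ioi s), ∀ i ∈ {i | s < a i}, r < a i :=
        (Filter.eventually_all_finite (hfin s hs)).mpr fun i hi =>
          mem_nhdsWithin_of_mem_nhds (Iio_mem_nhds hi)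
      obtain ⟨r, hr1, hr2⟩ := (h1.and self_mem_nhdsWithin).exists
      exact ⟨r, hr2, hr1⟩
    have hset : {i | r < a i} = {i | s < a i} :=
      Set.Subset.antisymm (fun i hi => hsr.trans hi) hr
    obtain ⟨A, hA⟩ := ((hfin 1 one_pos).image a).bddAbove
    have hne : {r : ℝ | 0 ≤ r ∧ Module.rank ℂ (eigenspaceAbove T r) ≤ (k : Cardinal)}.Nonempty := by
      refine ⟨max 1 A, by positivity, ?_⟩
      have hempty : {i | max 1 A < a i} = ∅ := by
        refine Set.eq_empty_of_forall_notMem fun i hi => ?_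
        obtain ⟨h1, h2⟩ := max_lt_iff.mp (show max 1 A < a i from hi)
        exact (hA ⟨i, h1, rfl⟩).not_gt h2
      rw [rank_eigenspaceAbove e hT ha (hfin _ (by positivity)), hempty]
      simp
    refine (hsr.trans_le (le_csInf hne fun q hq => ?_)).not_ge hle
    by_contra! hqr
    have h1 := (Submodule.rank_mono (eigenspaceAbove_anti T hqr.le)).trans hq.2
    rw [rank_eigenspaceAbove e hT ha (hfin r (hs.trans hsr)), hset, Nat.cast_le] at h1
    omega
  · rw [rank_eigenspaceAbove e hT ha (hfin s hs)]
    exact_mod_cast hle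

/-- If the range of `T` has dimension at most `k`, then `T` has at most `k` positive
eigenvalues. -/
theorem eigenvalueSeq_eq_zero {H : Type*} [AddCommGroup H] [Module ℂ H] {T : H →ₗ[ℂ] H} {k : ℕ}
    (h : Module.rank ℂ (LinearMap.range T) ≤ (k : Cardinal)) : eigenvalueSeq T k = 0 := by
  refine le_antisymm (csInf_le ⟨0, fun _ hr => hr.1⟩ ⟨le_rfl, ?_⟩)
    (Real.sInf_nonneg fun _ hr => hr.1)
  refine (Submodule.rank_mono (iSup_le fun μ v hv => ?_)).trans h
  rw [Module.End.mem_eigenspace_iff] at hv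
  have hμ : ((μ : ℝ) : ℂ) ≠ 0 := Complex.ofReal_ne_zero.mpr μ.2.ne'
  exact ⟨((μ : ℝ) : ℂ)⁻¹ • v, by rw [map_smul, hv, inv_smul_smul₀ hμ]⟩

/-- `eigenvalueSeq` is invariant under conjugation by linear equivalences. -/
theorem eigenvalueSeq_congr {H H' : Type u} [AddCommGroup H] [Module ℂ H] [AddCommGroup H']
    [Module ℂ H'] {T : H →ₗ[ℂ] H} {T' : H' →ₗ[ℂ] H'} (U : H ≃ₗ[ℂ] H')
    (hU : ∀ v, U (T v) = T' (U v)) : eigenvalueSeq T = eigenvalueSeq T' := by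
  have h (r : ℝ) : eigenspaceAbove T' r = (eigenspaceAbove T r).map (U : H →ₗ[ℂ] H') := by
    rw [eigenspaceAbove, eigenspaceAbove, Submodule.map_iSup]
    congr 1
    ext μ v
    rw [Module.End.mem_eigenspace_iff, Submodule.mem_map_equiv, Module.End.mem_eigenspace_iff,
      ← U.injective.eq_iff, hU, map_smul, U.apply_symm_apply]
  have hrank (r : ℝ) : Module.rank ℂ (eigenspaceAbove T' r) = Module.rank ℂ (eigenspaceAbove T r) :=
    (congrArg (fun p : Submodule ℂ H' => Module.rank ℂ p) (h r)).trans (LinearEquiv.rank_map_eq U _)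
  funext k
  simp only [eigenvalueSeq, hrank]

end HilbertSchmidt

/-! ### The Hoffman–Wielandt inequality for positive Hilbert–Schmidt operators -/

section HoffmanWielandt

universe u

variable {H : Type u} [NormedAddCommGroup H] [InnerProductSpace ℂ H]

theorem eigenvalueSeq_nonneg {H : Type*} [AddCommGroup H] [Module ℂ H] (T : H →ₗ[ℂ] H) (k : ℕ) :
    0 ≤ eigenvalueSeq T k :=
  Real.sInf_nonneg fun _ hr => hr.1

/-- Parseval's identity with values in `ℝ≥0∞`. -/
theorem tsum_ofReal_norm_inner_sq {ι : Type*} (b : HilbertBasis ι ℂ H) (v : H) :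
    ∑' i, ENNReal.ofReal (‖inner ℂ (b i) v‖ ^ 2) = ENNReal.ofReal (‖v‖ ^ 2) := by
  have h := Complex.hasSum_re (b.hasSum_inner_mul_inner v v)
  have h1 (i : ι) : (inner ℂ v (b i) * inner ℂ (b i) v).re = ‖inner ℂ (b i) v‖ ^ 2 := by
    rw [← inner_conj_symm v (b i), Complex.conj_mul', ← Complex.ofReal_pow, Complex.ofReal_re]
  have h2 : (inner ℂ v v).re = ‖v‖ ^ 2 := inner_self_eq_norm_sq (𝕜 := ℂ) v
  simp only [h1, h2] at h
  rw [← h.tsum_eq, ENNReal.ofReal_tsum_of_nonneg (fun _ => by positivity) h.summable]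

theorem ofReal_sq_add_ofReal_sq {x y : ℝ} (hx : 0 ≤ x) (hy : 0 ≤ y) :
    ENNReal.ofReal x ^ 2 + ENNReal.ofReal y ^ 2 =
      ENNReal.ofReal ((x - y) ^ 2) + 2 * (ENNReal.ofReal x * ENNReal.ofReal y) := by
  have h2 : (2 : ENNReal) = ENNReal.ofReal 2 := by simp
  rw [h2, ← ENNReal.ofReal_pow hx, ← ENNReal.ofReal_pow hy, ← ENNReal.ofReal_mul hx,
    ← ENNReal.ofReal_mul (by norm_num), ← ENNReal.ofReal_add (by positivity) (by positivity),
    ← ENNReal.ofReal_add (by positivity) (by positivity)]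
  congr 1
  ring

theorem norm_apply_eigenvector_sq {ι : Type*} {T : H →ₗ[ℂ] H} (e : HilbertBasis ι ℂ H) {a : ι → ℝ}
    (ha : ∀ i, T (e i) = (a i : ℂ) • e i) (i : ι) : ‖T (e i)‖ ^ 2 = a i ^ 2 := by
  rw [ha, norm_smul, e.orthonormal.1 i, Complex.norm_real, mul_one, Real.norm_eq_abs, sq_abs]

theorem HilbertSchmidtSqLE.isDecreasingRearrangement {T : H →ₗ[ℂ] H} {C : ℝ}
    (h : HilbertSchmidtSqLE T C) (hT : T.IsSymmetric) {ι : Type u} (e : HilbertBasis ι ℂ H)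
    {a : ι → ℝ} (ha : ∀ i, T (e i) = (a i : ℂ) • e i) :
    IsDecreasingRearrangement a (eigenvalueSeq T) := by
  refine isDecreasingRearrangement_eigenvalueSeq e hT ha fun s hs => ?_
  have hsum := h.summable e.orthonormal
  simp only [norm_apply_eigenvector_sq e ha] at hsum
  have hev := hsum.tendsto_cofinite_zero.eventually_lt_const (show (0 : ℝ) < s ^ 2 by positivity)
  refine (Filter.eventually_cofinite.mp hev).subset fun i hi => ?_
  exact not_lt.mpr (pow_le_pow_left₀ hs.le (le_of_lt hi) 2)

/-- The **Hoffman–Wielandt inequality** for positive Hilbert–Schmidt operators: the `ℓ²` distance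
between the decreasing sequences of eigenvalues is at most the Hilbert–Schmidt norm of the
difference. -/
theorem tsum_sq_sub_eigenvalueSeq_le [CompleteSpace H] [TopologicalSpace.SeparableSpace H]
    {T S : H →ₗ[ℂ] H} (hT : T.IsPositive) (hS : S.IsPositive) {C C' D : ℝ}
    (hTC : HilbertSchmidtSqLE T C) (hSC : HilbertSchmidtSqLE S C')
    (hD : HilbertSchmidtSqLE (T - S) D) :
    ∑' k, ENNReal.ofReal ((eigenvalueSeq T k - eigenvalueSeq S k) ^ 2) ≤ ENNReal.ofReal D := by
  have hcT : IsCompactOperator T :=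
    HilbertSchmidtSqLE.isCompactOperator (T := ⟨T, hT.isSymmetric.continuous⟩) hTC
  have hcS : IsCompactOperator S :=
    HilbertSchmidtSqLE.isCompactOperator (T := ⟨S, hS.isSymmetric.continuous⟩) hSC
  obtain ⟨ι, e, a, ha0, ha⟩ := exists_eigenbasis hT hcT
  obtain ⟨κ, f, b, hb0, hb⟩ := exists_eigenbasis hS hcS
  have : Countable ι := countable_of_orthonormal e.orthonormal
  have : Countable κ := countable_of_orthonormal f.orthonormal
  have hla := hTC.isDecreasingRearrangement hT.isSymmetric e ha
  have hlb := hSC.isDecreasingRearrangement hS.isSymmetric f hb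
  set l := eigenvalueSeq T
  set l' := eigenvalueSeq S
  -- The doubly stochastic matrix that compares the two eigenbases.
  let p : ι → κ → ENNReal := fun i j => ENNReal.ofReal (‖inner ℂ (f j) (e i)‖ ^ 2)
  have hrow (i : ι) : ∑' j, p i j = 1 := by
    rw [tsum_ofReal_norm_inner_sq, e.orthonormal.1 i]; simp
  have hcol (j : κ) : ∑' i, p i j = 1 := by
    simp only [p, norm_inner_symm (f j)]
    rw [tsum_ofReal_norm_inner_sq, f.orthonormal.1 j]; simp
  -- The Hilbert–Schmidt norm of `T - S`, expanded in both bases.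
  have hHS : ∑' i, ∑' j, p i j * ENNReal.ofReal ((a i - b j) ^ 2) ≤ ENNReal.ofReal D := by
    refine le_trans (le_of_eq (tsum_congr fun i => ?_)) (hD.tsum_ofReal_le e.orthonormal)
    rw [← tsum_ofReal_norm_inner_sq f]
    refine tsum_congr fun j => ?_
    have h1 : inner ℂ (f j) ((T - S) (e i)) = ((a i - b j : ℝ) : ℂ) * inner ℂ (f j) (e i) := by
      rw [LinearMap.sub_apply, inner_sub_right, ← hS.isSymmetric (f j) (e i), ha, hb,
        inner_smul_left, inner_smul_right, Complex.conj_ofReal]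
      push_cast
      ring
    rw [h1, norm_mul, mul_pow, Complex.norm_real, Real.norm_eq_abs, sq_abs, mul_comm,
      ENNReal.ofReal_mul (by positivity)]
  have hA : ∑' i, ∑' j, p i j * ENNReal.ofReal (a i) ^ 2 = ∑' k, ENNReal.ofReal (l k) ^ 2 := by
    rw [← hla.tsum_sq_eq]
    exact tsum_congr fun i => by rw [ENNReal.tsum_mul_right, hrow, one_mul]
  have hB : ∑' i, ∑' j, p i j * ENNReal.ofReal (b j) ^ 2 = ∑' k, ENNReal.ofReal (l' k) ^ 2 := by
    rw [← hlb.tsum_sq_eq, ENNReal.tsum_comm]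
    exact tsum_congr fun j => by rw [ENNReal.tsum_mul_right, hcol, one_mul]
  have hsq {T : H →ₗ[ℂ] H} {C : ℝ} (h : HilbertSchmidtSqLE T C) {ι : Type u}
      (e : HilbertBasis ι ℂ H) {a : ι → ℝ} (ha0 : ∀ i, 0 ≤ a i)
      (ha : ∀ i, T (e i) = (a i : ℂ) • e i) : ∑' i, ENNReal.ofReal (a i) ^ 2 ≠ ⊤ := by
    refine ne_top_of_le_ne_top ENNReal.ofReal_ne_top
      (le_trans (le_of_eq (tsum_congr fun i => ?_)) (h.tsum_ofReal_le e.orthonormal))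
    rw [norm_apply_eigenvector_sq e ha, ENNReal.ofReal_pow (ha0 i)]
  have hX := hla.tsum_mul_le hlb p (fun i => (hrow i).le) (fun j => (hcol j).le)
  set X := ∑' k, ENNReal.ofReal (l k) * ENNReal.ofReal (l' k)
  -- Expand the squares on both sides and cancel the common sums of squares.
  have h1 : ∑' k, ENNReal.ofReal (l k) ^ 2 + ∑' k, ENNReal.ofReal (l' k) ^ 2 =
      ∑' k, ENNReal.ofReal ((l k - l' k) ^ 2) + 2 * X := by
    rw [← ENNReal.tsum_add, ← ENNReal.tsum_mul_left, ← ENNReal.tsum_add]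
    exact tsum_congr fun k =>
      ofReal_sq_add_ofReal_sq (eigenvalueSeq_nonneg T k) (eigenvalueSeq_nonneg S k)
  have h2 : ∑' k, ENNReal.ofReal (l k) ^ 2 + ∑' k, ENNReal.ofReal (l' k) ^ 2 =
      ∑' i, ∑' j, p i j * ENNReal.ofReal ((a i - b j) ^ 2) +
        2 * ∑' i, ∑' j, p i j * (ENNReal.ofReal (a i) * ENNReal.ofReal (b j)) := by
    rw [← hA, ← hB]
    simp_rw [← ENNReal.tsum_mul_left, ← ENNReal.tsum_add]
    refine tsum_congr fun i => tsum_congr fun j => ?_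
    rw [← mul_add, ofReal_sq_add_ofReal_sq (ha0 i) (hb0 j)]
    ring
  have hfin : 2 * X ≠ ⊤ := by
    refine ne_top_of_le_ne_top ?_ (le_add_self.trans_eq h1.symm)
    rw [← hla.tsum_sq_eq, ← hlb.tsum_sq_eq]
    exact ENNReal.add_ne_top.mpr ⟨hsq hTC e ha0 ha, hsq hSC f hb0 hb⟩
  refine ENNReal.le_of_add_le_add_right hfin ?_
  rw [← h1, h2]
  gcongr

end HoffmanWielandt

/-! ### Integral operators with bounded kernels -/

theorem norm_sq_eq_integral {μ : Measure ℝ} (f : Lp ℂ 2 μ) : ‖f‖ ^ 2 = ∫ x, ‖f x‖ ^ 2 ∂μ := by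
  have h : inner ℂ f f = ((∫ x, ‖f x‖ ^ 2 ∂μ : ℝ) : ℂ) := by
    rw [L2.inner_def, ← integral_complex_ofReal]
    refine integral_congr_ae (Filter.Eventually.of_forall fun x => ?_)
    simp [inner_self_eq_norm_sq_to_K]
  rw [← inner_self_eq_norm_sq (𝕜 := ℂ) f, h]
  exact Complex.ofReal_re _

section KernelOp

variable (μ : Measure ℝ) [IsFiniteMeasure μ] (K : ℝ → ℝ → ℝ)
  (hK : Measurable (Function.uncurry K)) (C : ℝ) (hC : ∀ x y, |K x y| ≤ C)

theorem coeFn_kernelOp (f : Lp ℂ 2 μ) :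
    kernelOp μ K hK C hC f =ᵐ[μ] fun x => ∫ y, (K x y : ℂ) * f y ∂μ :=
  (memLp_kernel μ K hK C hC f).coeFn_toLp

/-- If `|K| ≤ M` almost everywhere, the squared Hilbert–Schmidt norm of the operator with kernel
`K` is at most `M ^ 2 * μ(ℝ) ^ 2`: for fixed `x` the values `(T eᵢ)(x)` are the Fourier
coefficients of `K(x, ·)`, so Bessel's inequality applies pointwise. -/
theorem hilbertSchmidtSqLE_kernelOp {M : ℝ} (hM : ∀ᵐ x ∂μ, ∀ᵐ y ∂μ, |K x y| ≤ M) :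
    HilbertSchmidtSqLE (kernelOp μ K hK C hC) (M ^ 2 * μ.real Set.univ ^ 2) := by
  intro ι e he F
  have hmem (x : ℝ) : MemLp (fun y => (K x y : ℂ)) 2 μ := by
    refine MemLp.of_bound ?_ C (Filter.Eventually.of_forall fun y => ?_)
    · exact (Complex.measurable_ofReal.comp (hK.comp measurable_prodMk_left)).aestronglyMeasurable
    · rw [Complex.norm_real, Real.norm_eq_abs]; exact hC x y
  have hinner (x : ℝ) (g : Lp ℂ 2 μ) :
      ∫ y, (K x y : ℂ) * g y ∂μ = inner ℂ ((hmem x).toLp _) g := by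
    rw [L2.inner_def]
    refine integral_congr_ae ?_
    filter_upwards [(hmem x).coeFn_toLp] with y hy
    rw [hy, RCLike.inner_apply, Complex.conj_ofReal, mul_comm]
  have hint (g : Lp ℂ 2 μ) : Integrable (fun x => ‖g x‖ ^ 2) μ :=
    (Lp.memLp g).integrable_norm_pow (by norm_num)
  simp_rw [norm_sq_eq_integral]
  rw [← integral_finsetSum _ fun i _ => hint _]
  have hbound : ∀ᵐ x ∂μ, ∑ i ∈ F, ‖kernelOp μ K hK C hC (e i) x‖ ^ 2 ≤ M ^ 2 * μ.real Set.univ := by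
    have hall : ∀ᵐ x ∂μ, ∀ i ∈ F, kernelOp μ K hK C hC (e i) x = ∫ y, (K x y : ℂ) * e i y ∂μ :=
      (Filter.eventually_all_finset F).mpr fun i _ => coeFn_kernelOp μ K hK C hC (e i)
    filter_upwards [hM, hall] with x hx hxF
    calc ∑ i ∈ F, ‖kernelOp μ K hK C hC (e i) x‖ ^ 2
        = ∑ i ∈ F, ‖inner ℂ (e i) ((hmem x).toLp _)‖ ^ 2 :=
          Finset.sum_congr rfl fun i hi => by rw [hxF i hi, hinner, norm_inner_symm]
      _ ≤ ‖(hmem x).toLp _‖ ^ 2 := he.sum_inner_products_le _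
      _ = ∫ y, ‖(hmem x).toLp _ y‖ ^ 2 ∂μ := norm_sq_eq_integral _
      _ ≤ ∫ _, M ^ 2 ∂μ := by
          refine integral_mono_ae (hint _) (integrable_const _) ?_
          filter_upwards [hx, (hmem x).coeFn_toLp] with y hy hy'
          rw [hy', Complex.norm_real, Real.norm_eq_abs]
          gcongr
      _ = M ^ 2 * μ.real Set.univ := by rw [integral_const, smul_eq_mul, mul_comm]
  refine (integral_mono_ae (integrable_finsetSum _ fun i _ => hint _) (integrable_const _)
    hbound).trans_eq ?_
  rw [integral_const, smul_eq_mul]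
  ring

theorem kernelOp_sub (K' : ℝ → ℝ → ℝ) (hK' : Measurable (Function.uncurry K')) (C' : ℝ)
    (hC' : ∀ x y, |K' x y| ≤ C') (hC'' : ∀ x y, |K x y - K' x y| ≤ C + C') :
    kernelOp μ K hK C hC - kernelOp μ K' hK' C' hC' =
      kernelOp μ (fun x y => K x y - K' x y) (hK.sub hK') (C + C') hC'' := by
  refine LinearMap.ext fun f => Lp.ext ?_
  rw [LinearMap.sub_apply]
  filter_upwards [Lp.coeFn_sub (kernelOp μ K hK C hC f) (kernelOp μ K' hK' C' hC' f),
    coeFn_kernelOp μ K hK C hC f, coeFn_kernelOp μ K' hK' C' hC' f,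
    coeFn_kernelOp μ (fun x y => K x y - K' x y) (hK.sub hK') (C + C') hC'' f] with x h1 h2 h3 h4
  rw [h1, Pi.sub_apply, h2, h3, h4, ← integral_sub (integrable_kernel μ K hK C hC f x)
    (integrable_kernel μ K' hK' C' hC' f x)]
  refine integral_congr_ae (Filter.Eventually.of_forall fun y => ?_)
  push_cast
  ring

/-- An integral operator whose kernel is `(x, y) ↦ charFun ν (x - y)` for a finite measure `ν` is
positive: by Fubini, `⟪f, T f⟫ = ∫ |∫ exp(-iyω) f(y) dμ(y)|² dν(ω)`. This is the elementary half
of Bochner's theorem. -/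
theorem isPositive_kernelOp (ν : Measure ℝ) [IsFiniteMeasure ν]
    (h : ∀ᵐ x ∂μ, ∀ᵐ y ∂μ, (K x y : ℂ) = charFun ν (x - y)) :
    (kernelOp μ K hK C hC).IsPositive := by
  have key (f : Lp ℂ 2 μ) : inner ℂ f (kernelOp μ K hK C hC f) =
      ((∫ ω, ‖∫ y, Complex.exp (-(y * ω * Complex.I)) * f y ∂μ‖ ^ 2 ∂ν : ℝ) : ℂ) := by
    have hf : Integrable (fun y => f y) μ := (Lp.memLp f).integrable (by norm_num)
    have hf' : Integrable (fun y => (starRingEnd ℂ) (f y)) μ := by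
      simpa using! Complex.conjCLE.toContinuousLinearMap.integrable_comp hf
    have hexp (t : ℝ) : ‖Complex.exp (t * Complex.I)‖ = 1 := Complex.norm_exp_ofReal_mul_I t
    have hprod : Integrable (fun q : ℝ × ℝ => (starRingEnd ℂ) (f q.1) * f q.2) (μ.prod μ) :=
      hf'.mul_prod hf
    have htriple : Integrable (fun z : (ℝ × ℝ) × ℝ =>
        Complex.exp ((z.1.1 - z.1.2) * z.2 * Complex.I) *
          ((starRingEnd ℂ) (f z.1.1) * f z.1.2)) ((μ.prod μ).prod ν) := by
      have h1 := hprod.mul_prod (integrable_const (1 : ℂ) (μ := ν))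
      simp only [mul_one] at h1
      refine h1.bdd_mul (c := 1) ?_ (Filter.Eventually.of_forall fun z => ?_)
      · exact (by fun_prop : Continuous fun z : (ℝ × ℝ) × ℝ =>
          Complex.exp ((z.1.1 - z.1.2) * z.2 * Complex.I)).aestronglyMeasurable
      · have := hexp ((z.1.1 - z.1.2) * z.2)
        push_cast at this
        exact this.le
    have hdouble : Integrable (fun q : ℝ × ℝ =>
        ∫ ω, Complex.exp ((q.1 - q.2) * ω * Complex.I) * ((starRingEnd ℂ) (f q.1) * f q.2) ∂ν)
        (μ.prod μ) := htriple.integral_prod_left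
    calc inner ℂ f (kernelOp μ K hK C hC f)
        = ∫ x, ∫ y, ∫ ω, Complex.exp ((x - y) * ω * Complex.I) *
            ((starRingEnd ℂ) (f x) * f y) ∂ν ∂μ ∂μ := by
          rw [L2.inner_def]
          refine integral_congr_ae ?_
          filter_upwards [coeFn_kernelOp μ K hK C hC f, h] with x hx hxK
          rw [hx, RCLike.inner_apply, ← integral_mul_const]
          refine integral_congr_ae ?_
          filter_upwards [hxK] with y hy
          rw [hy, charFun_apply_real, integral_mul_const]
          push_cast
          ring
      _ = ∫ q, ∫ ω, Complex.exp ((q.1 - q.2) * ω * Complex.I) *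
            ((starRingEnd ℂ) (f q.1) * f q.2) ∂ν ∂(μ.prod μ) :=
          (integral_prod _ hdouble).symm
      _ = ∫ ω, ∫ q, Complex.exp ((q.1 - q.2) * ω * Complex.I) *
            ((starRingEnd ℂ) (f q.1) * f q.2) ∂(μ.prod μ) ∂ν :=
          integral_integral_swap htriple
      _ = _ := by
          rw [← integral_complex_ofReal]
          refine integral_congr_ae (Filter.Eventually.of_forall fun ω => ?_)
          simp only
          rw [Complex.ofReal_pow, ← Complex.conj_mul', ← integral_conj,
            ← integral_prod_mul]
          refine integral_congr_ae (Filter.Eventually.of_forall fun q => ?_)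
          simp only [map_mul, ← Complex.exp_conj, map_neg, Complex.conj_ofReal, Complex.conj_I]
          have : Complex.exp ((q.1 - q.2) * ω * Complex.I) =
              Complex.exp (-(q.1 * ω * -Complex.I)) * Complex.exp (-(q.2 * ω * Complex.I)) := by
            rw [← Complex.exp_add]; ring_nf
          rw [this]
          ring
  rw [LinearMap.isPositive_iff_complex]
  intro f
  rw [← inner_conj_symm, key, Complex.conj_ofReal]
  exact ⟨by simp, by simpa using integral_nonneg fun _ => by positivity⟩

end KernelOp

/-! ### The two kernels as Fourier transforms of positive measures -/

section Kernels

open Complex in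
/-- The Dirichlet kernel is a sum of `N` exponentials at equispaced frequencies centred at `0`:
multiplied by `sin(πt)`, the sum telescopes. -/
theorem sin_mul_sum_exp (N : ℕ) (t : ℝ) :
    Complex.sin (Real.pi * t) *
      ∑ n ∈ Finset.range N, Complex.exp (t * (Real.pi * (2 * n + 1 - N) : ℝ) * I) =
      Complex.sin (N * Real.pi * t) := by
  have h (n : ℕ) : Complex.sin (Real.pi * t) *
      Complex.exp (t * (Real.pi * (2 * n + 1 - N) : ℝ) * I) =
      Complex.exp (Real.pi * t * (2 * (n + 1 : ℕ) - N) * I) * (-I / 2) -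
        Complex.exp (Real.pi * t * (2 * n - N) * I) * (-I / 2) := by
    have h1 : Complex.exp (Real.pi * t * (2 * (n + 1 : ℕ) - N) * I) =
        Complex.exp (t * (Real.pi * (2 * n + 1 - N) : ℝ) * I) * Complex.exp (Real.pi * t * I) := by
      rw [← Complex.exp_add]; push_cast; ring_nf
    have h2 : Complex.exp (Real.pi * t * (2 * n - N) * I) =
        Complex.exp (t * (Real.pi * (2 * n + 1 - N) : ℝ) * I) *
          Complex.exp (-(Real.pi * t) * I) := by
      rw [← Complex.exp_add]; push_cast; ring_nf
    rw [h1, h2, Complex.sin]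
    ring
  rw [Finset.mul_sum, Finset.sum_congr rfl fun n _ => h n, Finset.sum_range_sub
    (fun n : ℕ => Complex.exp (Real.pi * t * (2 * n - N) * I) * (-I / 2)), Complex.sin]
  push_cast
  ring_nf

theorem dirichletKernel_eq_sum_exp (N : ℕ) {x y : ℝ} (h : Real.sin (Real.pi * (x - y)) ≠ 0) :
    (dirichletKernel N x y : ℂ) = ∑ n ∈ Finset.range N,
      Complex.exp ((x - y : ℝ) * (Real.pi * (2 * n + 1 - N) : ℝ) * Complex.I) := by
  have h1 := sin_mul_sum_exp N (x - y)
  have h2 : Complex.sin (Real.pi * (x - y : ℝ)) ≠ 0 := by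
    rw [← Complex.ofReal_mul, ← Complex.ofReal_sin]
    exact_mod_cast h
  rw [dirichletKernel, eq_comm, Complex.ofReal_div, Complex.ofReal_sin, Complex.ofReal_sin]
  push_cast at h1 h2 ⊢
  rw [eq_div_iff h2, mul_comm, h1]

/-- The spectral measure of the Dirichlet kernel: unit masses at `N` equispaced frequencies. -/
noncomputable def dirichletMeasure (N : ℕ) : Measure ℝ :=
  ∑ n ∈ Finset.range N, Measure.dirac (Real.pi * (2 * n + 1 - N))

instance (N : ℕ) : IsFiniteMeasure (dirichletMeasure N) := by
  unfold dirichletMeasure; infer_instance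

theorem charFun_dirichletMeasure (N : ℕ) (t : ℝ) :
    charFun (dirichletMeasure N) t =
      ∑ n ∈ Finset.range N, Complex.exp (t * (Real.pi * (2 * n + 1 - N) : ℝ) * Complex.I) := by
  rw [charFun_apply_real, dirichletMeasure, integral_finsetSum_measure fun n _ =>
    integrable_dirac (by simp)]
  simp_rw [integral_dirac]

/-- The spectral measure of the sinc kernel: Lebesgue measure on `(-c, c]`, divided by `2π`. -/
noncomputable def sincMeasure (c : ℝ) : Measure ℝ :=
  ENNReal.ofReal (2 * Real.pi)⁻¹ • volume.restrict (Set.Ioc (-c) c)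

instance (c : ℝ) : IsFiniteMeasure (sincMeasure c) := by
  unfold sincMeasure; exact Measure.smul_finite _ ENNReal.ofReal_ne_top

theorem charFun_sincMeasure {c t : ℝ} (hc : 0 ≤ c) (ht : t ≠ 0) :
    charFun (sincMeasure c) t = (Real.sin (c * t) / (Real.pi * t) : ℝ) := by
  have ht' : (t : ℂ) * Complex.I ≠ 0 := by simp [ht]
  have hπ : (Real.pi : ℂ) ≠ 0 := by exact_mod_cast Real.pi_ne_zero
  have htc : (t : ℂ) ≠ 0 := by exact_mod_cast ht
  have h1 : ∫ x in Set.Ioc (-c) c, Complex.exp (t * x * Complex.I) =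
      ∫ x in (-c)..c, Complex.exp (t * Complex.I * x) := by
    rw [intervalIntegral.integral_of_le (by linarith)]
    congr 1 with x
    ring_nf
  rw [charFun_apply_real, sincMeasure, integral_smul_measure, h1, integral_exp_mul_complex ht',
    ENNReal.toReal_ofReal (by positivity), Complex.real_smul]
  have h2 : Complex.exp (t * Complex.I * c) - Complex.exp (t * Complex.I * (-c : ℝ)) =
      2 * Complex.I * Complex.sin (c * t) := by
    rw [Complex.sin]
    push_cast
    have e1 : (t : ℂ) * Complex.I * c = c * t * Complex.I := by ring
    have e2 : (t : ℂ) * Complex.I * -c = -(c * t) * Complex.I := by ring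
    rw [e1, e2]
    ring_nf
    rw [Complex.I_sq]
    ring
  rw [h2]
  push_cast
  field_simp

/-- On `(-W, W)²` with `W ≤ 1/2`, the denominator of the Dirichlet kernel vanishes only on the
diagonal. -/
theorem ae_ae_sin_ne_zero {W : ℝ} (hW : W ≤ 1 / 2) :
    ∀ᵐ x ∂volume.restrict (Set.Ioo (-W) W), ∀ᵐ y ∂volume.restrict (Set.Ioo (-W) W),
      Real.sin (Real.pi * (x - y)) ≠ 0 := by
  filter_upwards [ae_restrict_mem measurableSet_Ioo] with x hx
  have hne : ∀ᵐ y ∂volume.restrict (Set.Ioo (-W) W), y ≠ x :=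
    ae_restrict_of_ae (Measure.ae_ne volume x)
  filter_upwards [ae_restrict_mem measurableSet_Ioo, hne] with y hy hyx
  rw [Ne, Real.sin_eq_zero_iff_of_lt_of_lt (by nlinarith [Real.pi_pos, hx.1, hx.2, hy.1, hy.2])
    (by nlinarith [Real.pi_pos, hx.1, hx.2, hy.1, hy.2])]
  exact mul_ne_zero Real.pi_ne_zero (sub_ne_zero.mpr hyx.symm)

theorem isPositive_QTilde {W : ℝ} (hW : W ≤ 1 / 2) (N : ℕ) : (QTilde W N).IsPositive := by
  refine isPositive_kernelOp _ _ _ _ _ (dirichletMeasure N) ?_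
  filter_upwards [ae_ae_sin_ne_zero hW] with x hx
  filter_upwards [hx] with y hy
  rw [dirichletKernel_eq_sum_exp N hy, charFun_dirichletMeasure]

theorem isPositive_kernelOp_sincKernel (μ : Measure ℝ) [IsFiniteMeasure μ] [NullSingletonClass μ]
    {c : ℝ} (hc : 0 ≤ c) :
    (kernelOp μ (sincKernel c) (measurable_sincKernel c) (|c| / Real.pi)
      (abs_sincKernel_le c)).IsPositive := by
  refine isPositive_kernelOp _ _ _ _ _ (sincMeasure c) (Filter.Eventually.of_forall fun x => ?_)
  filter_upwards [Measure.ae_ne μ x] with y hy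
  rw [charFun_sincMeasure hc (sub_ne_zero.mpr hy.symm), sincKernel]

/-- A kernel that is a sum of `N` exponentials of `x - y` gives an operator of rank at most `N`. -/
theorem rank_range_kernelOp_le (μ : Measure ℝ) [IsFiniteMeasure μ] (K : ℝ → ℝ → ℝ)
    (hK : Measurable (Function.uncurry K)) (C : ℝ) (hC : ∀ x y, |K x y| ≤ C) (N : ℕ) (ω : ℕ → ℝ)
    (h : ∀ᵐ x ∂μ, ∀ᵐ y ∂μ, (K x y : ℂ) =
      ∑ n ∈ Finset.range N, Complex.exp ((x - y : ℝ) * (ω n : ℝ) * Complex.I)) :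
    Module.rank ℂ (LinearMap.range (kernelOp μ K hK C hC)) ≤ (N : Cardinal) := by
  let u : ℕ → ℝ → ℂ := fun n x => Complex.exp ((x * ω n : ℝ) * Complex.I)
  have hu (n : ℕ) : MemLp (u n) 2 μ := by
    refine MemLp.of_bound (C := 1) ?_ (Filter.Eventually.of_forall fun x =>
      (Complex.norm_exp_ofReal_mul_I _).le)
    exact (by fun_prop : Continuous (u n)).aestronglyMeasurable
  let v : ℕ → ℝ → ℂ := fun n y => Complex.exp ((-(y * ω n) : ℝ) * Complex.I)
  have hle : LinearMap.range (kernelOp μ K hK C hC) ≤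
      Submodule.span ℂ ((fun n => (hu n).toLp (u n)) '' (Finset.range N : Set ℕ)) := by
    rintro _ ⟨f, rfl⟩
    let d : ℕ → ℂ := fun n => ∫ y, v n y * f y ∂μ
    have hf : Integrable (fun y => f y) μ := (Lp.memLp f).integrable (by norm_num)
    have hi (n : ℕ) : Integrable (fun y => v n y * f y) μ :=
      hf.bdd_mul (c := 1) (by fun_prop : Continuous (v n)).aestronglyMeasurable
        (Filter.Eventually.of_forall fun y => (Complex.norm_exp_ofReal_mul_I _).le)
    have hexp (n : ℕ) (x y : ℝ) :
        Complex.exp ((x - y : ℝ) * (ω n : ℝ) * Complex.I) * f y = u n x * (v n y * f y) := by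
      rw [← mul_assoc, ← Complex.exp_add]
      push_cast
      ring_nf
    have hsum : kernelOp μ K hK C hC f = ∑ n ∈ Finset.range N, d n • (hu n).toLp (u n) := by
      refine Lp.ext ?_
      have hcoe : ∀ᵐ x ∂μ, ∀ n ∈ Finset.range N,
          (d n • (hu n).toLp (u n) : Lp ℂ 2 μ) x = u n x * d n := by
        refine (Filter.eventually_all_finset _).mpr fun n _ => ?_
        filter_upwards [Lp.coeFn_smul (d n) ((hu n).toLp (u n)), (hu n).coeFn_toLp] with x h1 h2
        rw [h1, Pi.smul_apply, h2, smul_eq_mul, mul_comm]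
      filter_upwards [coeFn_kernelOp μ K hK C hC f, Lp.coeFn_finsetSum (Finset.range N)
        (fun n => d n • (hu n).toLp (u n)), h, hcoe] with x h1 h2 h3 h4
      rw [h1, h2, Finset.sum_apply, Finset.sum_congr rfl h4]
      calc ∫ y, (K x y : ℂ) * f y ∂μ
          = ∫ y, ∑ n ∈ Finset.range N, u n x * (v n y * f y) ∂μ := by
            refine integral_congr_ae ?_
            filter_upwards [h3] with y hy
            rw [hy, Finset.sum_mul]
            exact Finset.sum_congr rfl fun n _ => hexp n x y
        _ = ∑ n ∈ Finset.range N, u n x * d n := by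
            rw [integral_finsetSum _ fun n _ => (hi n).const_mul _]
            exact Finset.sum_congr rfl fun n _ => integral_const_mul _ _
    rw [hsum]
    exact Submodule.sum_mem _ fun n hn => Submodule.smul_mem _ _
      (Submodule.subset_span ⟨n, Finset.mem_coe.mpr hn, rfl⟩)
  refine (Submodule.rank_mono hle).trans ((rank_span_le _).trans (Cardinal.mk_image_le.trans ?_))
  simp

theorem rank_range_QTilde_le {W : ℝ} (hW : W ≤ 1 / 2) (N : ℕ) :
    Module.rank ℂ (LinearMap.range (QTilde W N)) ≤ (N : Cardinal) := by
  refine rank_range_kernelOp_le _ _ _ _ _ N (fun n => Real.pi * (2 * n + 1 - N)) ?_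
  filter_upwards [ae_ae_sin_ne_zero hW] with x hx
  filter_upwards [hx] with y hy
  exact dirichletKernel_eq_sum_exp N hy

/-- The difference of the two kernels on `(-W, W)²`. With `u = π |x - y| < 2πW = U`, it is at most
`1 / sin u - 1 / u ≤ u² / (6 sin u) ≤ U² / (6 sin U)`. -/
theorem abs_dirichletKernel_sub_sincKernel_le {W : ℝ} (hW : W < 1 / 2) (N : ℕ)
    {x y : ℝ} (hx : x ∈ Set.Ioo (-W) W) (hy : y ∈ Set.Ioo (-W) W) :
    |dirichletKernel N x y - sincKernel (Real.pi * N) x y| ≤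
      2 * Real.pi ^ 2 * W ^ 2 / (3 * Real.sin (2 * Real.pi * W)) := by
  have hπ := Real.pi_pos
  have hW0 : 0 < W := by linarith [hx.1, hx.2]
  have hUpos : 0 < 2 * Real.pi * W := by positivity
  have hUlt : 2 * Real.pi * W < Real.pi := by nlinarith
  have hsU : 0 < Real.sin (2 * Real.pi * W) := Real.sin_pos_of_pos_of_lt_pi hUpos hUlt
  wlog hxy : y ≤ x generalizing x y with H
  · have h1 : dirichletKernel N x y = dirichletKernel N y x := by
      rw [dirichletKernel, dirichletKernel, ← neg_sub y x, mul_neg, mul_neg, Real.sin_neg,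
        Real.sin_neg, neg_div_neg_eq]
    have h2 : sincKernel (Real.pi * N) x y = sincKernel (Real.pi * N) y x := by
      rw [sincKernel, sincKernel, ← neg_sub y x, mul_neg, mul_neg, Real.sin_neg, neg_div_neg_eq]
    rw [h1, h2]
    exact H hy hx (le_of_not_ge hxy)
  rcases hxy.eq_or_lt with rfl | hlt
  · simp only [dirichletKernel, sincKernel, sub_self, mul_zero, Real.sin_zero, div_zero, abs_zero]
    positivity
  set u := Real.pi * (x - y) with hu
  have hu0 : 0 < u := mul_pos hπ (sub_pos.mpr hlt)
  have huU : u < 2 * Real.pi * W := by rw [hu]; nlinarith [hx.2, hy.1]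
  have hsu : 0 < Real.sin u := Real.sin_pos_of_pos_of_lt_pi hu0 (huU.trans hUlt)
  set U := 2 * Real.pi * W with hU
  -- Concavity of `sin` on `[0, π]`.
  have hconc : u / U * Real.sin U ≤ Real.sin u := by
    have h := strictConcaveOn_sin_Icc.concaveOn.2 (⟨hUpos.le, hUlt.le⟩ : U ∈ Set.Icc 0 Real.pi)
      (⟨le_rfl, hπ.le⟩ : (0 : ℝ) ∈ Set.Icc 0 Real.pi) (div_nonneg hu0.le hUpos.le)
      (sub_nonneg.mpr ((div_le_one hUpos).mpr huU.le)) (add_sub_cancel (u / U) 1)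
    simpa [div_mul_cancel₀ _ hUpos.ne'] using h
  have hsplit : dirichletKernel N x y - sincKernel (Real.pi * N) x y =
      Real.sin (N * u) * ((u - Real.sin u) / (u * Real.sin u)) := by
    have e1 : (N : ℝ) * Real.pi * (x - y) = N * u := by rw [hu]; ring
    have e2 : Real.pi * N * (x - y) = N * u := by rw [hu]; ring
    rw [dirichletKernel, sincKernel, e1, e2, ← hu]
    field_simp
  have hnn : 0 ≤ (u - Real.sin u) / (u * Real.sin u) :=
    div_nonneg (sub_nonneg.mpr (Real.sin_le hu0.le)) (by positivity)
  calc |dirichletKernel N x y - sincKernel (Real.pi * N) x y|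
      ≤ (u - Real.sin u) / (u * Real.sin u) := by
        rw [hsplit, abs_mul, abs_of_nonneg hnn]
        exact mul_le_of_le_one_left hnn (Real.abs_sin_le_one _)
    _ ≤ (u ^ 3 / 6) / (u * (u / U * Real.sin U)) := by
        have := Real.sin_ge_sub_cube hu0.le
        gcongr
        linarith
    _ = u * U / (6 * Real.sin U) := by
        field_simp
    _ ≤ U * U / (6 * Real.sin U) := by gcongr
    _ = 2 * Real.pi ^ 2 * W ^ 2 / (3 * Real.sin U) := by
        rw [hU]; field_simp; ring

end Kernels

/-! ### Rescaling -/

section Rescaling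

theorem memLp_comp_of_map_eq_smul {μ ν : Measure ℝ} {φ : ℝ → ℝ} (hφ : Measurable φ) {c : ENNReal}
    (hc : c ≠ ⊤) (hmap : μ.map φ = c • ν) (f : Lp ℂ 2 ν) : MemLp (f ∘ φ) 2 μ :=
  (hmap ▸ (Lp.memLp f).smul_measure hc : MemLp f 2 (μ.map φ)).comp_of_map hφ.aemeasurable

/-- Composition `f ↦ f ∘ φ` as a linear map between `L²` spaces, for a measurable map `φ` that
carries `μ` to a finite multiple of `ν`. -/
noncomputable def compLp {μ ν : Measure ℝ} {φ : ℝ → ℝ} (hφ : Measurable φ) {c : ENNReal}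
    (hc : c ≠ ⊤) (hmap : μ.map φ = c • ν) : Lp ℂ 2 ν →ₗ[ℂ] Lp ℂ 2 μ :=
  have hq : Measure.QuasiMeasurePreserving φ μ ν :=
    ⟨hφ, hmap ▸ Measure.smul_absolutelyContinuous⟩
  { toFun f := (memLp_comp_of_map_eq_smul hφ hc hmap f).toLp _
    map_add' f g := by
      rw [← MemLp.toLp_add, MemLp.toLp_eq_toLp_iff]
      exact hq.ae_eq_comp (Lp.coeFn_add f g)
    map_smul' a f := by
      rw [RingHom.id_apply, ← MemLp.toLp_const_smul, MemLp.toLp_eq_toLp_iff]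
      exact hq.ae_eq_comp (Lp.coeFn_smul a f) }

variable {μ ν : Measure ℝ} {φ ψ : ℝ → ℝ} (hφ : Measurable φ) (hψ : Measurable ψ) {c d : ENNReal}
  (hc : c ≠ ⊤) (hd : d ≠ ⊤) (hmap : μ.map φ = c • ν) (hmap' : ν.map ψ = d • μ)

theorem coeFn_compLp (f : Lp ℂ 2 ν) : compLp hφ hc hmap f =ᵐ[μ] f ∘ φ :=
  (memLp_comp_of_map_eq_smul hφ hc hmap f).coeFn_toLp

theorem compLp_compLp (h : ∀ x, φ (ψ x) = x) (f : Lp ℂ 2 ν) :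
    compLp hψ hd hmap' (compLp hφ hc hmap f) = f := by
  have hq : Measure.QuasiMeasurePreserving ψ ν μ :=
    ⟨hψ, hmap' ▸ Measure.smul_absolutelyContinuous⟩
  refine Lp.ext ?_
  filter_upwards [coeFn_compLp hψ hd hmap' (compLp hφ hc hmap f),
    hq.ae_eq_comp (coeFn_compLp hφ hc hmap f)] with x h1 h2
  rw [h1, h2]
  simp [h]

theorem map_mul_restrict_Ioo {a r : ℝ} (ha : 0 < a) :
    (volume.restrict (Set.Ioo (-r) r)).map (a * ·) =
      ENNReal.ofReal a⁻¹ • volume.restrict (Set.Ioo (-(a * r)) (a * r)) := by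
  have hpre : (a * · : ℝ → ℝ) ⁻¹' Set.Ioo (-(a * r)) (a * r) = Set.Ioo (-r) r := by
    ext x
    simp only [Set.mem_preimage, Set.mem_Ioo, ← mul_neg, mul_lt_mul_iff_right₀ ha]
  rw [← hpre, ← Measure.restrict_map (measurable_const_mul a) measurableSet_Ioo,
    Real.map_volume_mul_left ha.ne', Measure.restrict_smul, abs_of_pos (inv_pos.mpr ha)]

theorem sincKernel_mul (a c x y : ℝ) (ha : a ≠ 0) :
    sincKernel (c * a) x y = a * sincKernel c (a * x) (a * y) := by
  have h1 : c * (a * x - a * y) = c * a * (x - y) := by ring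
  have h2 : Real.pi * (a * x - a * y) = a * (Real.pi * (x - y)) := by ring
  rw [sincKernel, sincKernel, h1, h2, mul_div_assoc', mul_div_mul_left _ _ ha]

/-- The substitution `x ↦ W x` conjugates the operator with kernel `sincKernel c` on `L²(-W, W)`
to `QSinc (c * W)`, so they have the same eigenvalues. -/
theorem eigenvalueSeq_kernelOp_sincKernel {W : ℝ} (hW : 0 < W) (c : ℝ) :
    eigenvalueSeq (kernelOp (volume.restrict (Set.Ioo (-W) W)) (sincKernel c)
      (measurable_sincKernel c) (|c| / Real.pi) (abs_sincKernel_le c)) =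
      eigenvalueSeq (QSinc (c * W)) := by
  have hmap := map_mul_restrict_Ioo (r := 1) hW
  rw [mul_one] at hmap
  have hmap' := map_mul_restrict_Ioo (r := W) (inv_pos.mpr hW)
  rw [inv_mul_cancel₀ hW.ne'] at hmap'
  have hc : ENNReal.ofReal W⁻¹ ≠ ⊤ := ENNReal.ofReal_ne_top
  have hc' : ENNReal.ofReal W⁻¹⁻¹ ≠ ⊤ := ENNReal.ofReal_ne_top
  have hm := measurable_const_mul W
  have hm' := measurable_const_mul W⁻¹
  let U : Lp ℂ 2 (volume.restrict (Set.Ioo (-W) W)) ≃ₗ[ℂ]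
      Lp ℂ 2 (volume.restrict (Set.Ioo (-1 : ℝ) 1)) :=
    LinearEquiv.ofLinearMap (compLp hm hc hmap) (compLp hm' hc' hmap')
      (LinearMap.ext fun f => compLp_compLp hm' hm hc' hc hmap' hmap
        (fun x => inv_mul_cancel_left₀ hW.ne' x) f)
      (LinearMap.ext fun f => compLp_compLp hm hm' hc hc' hmap hmap'
        (fun x => mul_inv_cancel_left₀ hW.ne' x) f)
  refine eigenvalueSeq_congr U fun f => Lp.ext ?_
  have hUf (g) : U g =ᵐ[volume.restrict (Set.Ioo (-1) 1)] fun x => g (W * x) :=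
    coeFn_compLp hm hc hmap g
  have hq : Measure.QuasiMeasurePreserving (W * ·) (volume.restrict (Set.Ioo (-1 : ℝ) 1))
      (volume.restrict (Set.Ioo (-W) W)) :=
    ⟨measurable_const_mul W, hmap ▸ Measure.smul_absolutelyContinuous⟩
  filter_upwards [hUf (kernelOp _ (sincKernel c) (measurable_sincKernel c) (|c| / Real.pi)
      (abs_sincKernel_le c) f), hq.ae_eq_comp (coeFn_kernelOp _ (sincKernel c)
      (measurable_sincKernel c) (|c| / Real.pi) (abs_sincKernel_le c) f),
    coeFn_kernelOp _ (sincKernel (c * W)) (measurable_sincKernel (c * W)) (|c * W| / Real.pi)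
      (abs_sincKernel_le (c * W)) (U f)] with x h1 h2 h3
  simp only [Function.comp_apply] at h2
  rw [h1, h2, QSinc, h3]
  have hsub : ∫ y in Set.Ioo (-1 : ℝ) 1, (sincKernel c (W * x) (W * y) : ℂ) * f (W * y) =
      (W⁻¹ : ℝ) • ∫ z in Set.Ioo (-W) W, (sincKernel c (W * x) z : ℂ) * f z := by
    have h := (measurableEmbedding_mulLeft₀ hW.ne').integral_map
      (μ := volume.restrict (Set.Ioo (-1 : ℝ) 1)) (fun z => (sincKernel c (W * x) z : ℂ) * f z)
    rw [← h, hmap, integral_smul_measure, ENNReal.toReal_ofReal (inv_pos.mpr hW).le]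
  have hcongr : ∫ y in Set.Ioo (-1 : ℝ) 1, (sincKernel (c * W) x y : ℂ) * U f y =
      W * ∫ y in Set.Ioo (-1 : ℝ) 1, (sincKernel c (W * x) (W * y) : ℂ) * f (W * y) := by
    rw [← integral_const_mul]
    refine integral_congr_ae ?_
    filter_upwards [hUf f] with y hy
    rw [hy, sincKernel_mul W c x y hW.ne']
    push_cast
    ring
  rw [hcongr, hsub, Complex.real_smul, ← mul_assoc, ← Complex.ofReal_mul, mul_inv_cancel₀ hW.ne',
    Complex.ofReal_one, one_mul]

end Rescaling

/-! ### The eigenvalue comparison -/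

theorem lambdaTilde_eq {W : ℝ} (hW : W ≤ 1 / 2) (N k : ℕ) :
    lambdaTilde W N k = eigenvalueSeq (QTilde W N) k := by
  rw [lambdaTilde]
  split_ifs with h
  · rfl
  · refine (eigenvalueSeq_eq_zero ((rank_range_QTilde_le hW N).trans ?_)).symm
    exact_mod_cast not_lt.mp h

theorem tsum_sq_sub_le {W : ℝ} (hW : W ∈ Set.Ioo (0 : ℝ) (1 / 2)) (N : ℕ) :
    ∑' k, ENNReal.ofReal ((lambdaTilde W N k - lambdaSinc (Real.pi * N * W) k) ^ 2) ≤
      ENNReal.ofReal ((W ^ 3 * (4 * Real.pi ^ 2 / (3 * Real.sin (2 * Real.pi * W)))) ^ 2) := by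
  have : Fact ((2 : ENNReal) ≠ ⊤) := ⟨by norm_num⟩
  set μ := volume.restrict (Set.Ioo (-W) W)
  have hμ : μ.real Set.univ = 2 * W := by
    rw [measureReal_restrict_apply_univ, Real.volume_real_Ioo_of_le (by linarith [hW.1])]
    ring
  have hS := isPositive_kernelOp_sincKernel μ (c := Real.pi * N) (by positivity)
  have hC'' (x y : ℝ) : |dirichletKernel N x y - sincKernel (Real.pi * N) x y| ≤
      N + |Real.pi * N| / Real.pi :=
    (abs_sub _ _).trans (add_le_add (abs_dirichletKernel_le N x y) (abs_sincKernel_le _ x y))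
  have hD : HilbertSchmidtSqLE (QTilde W N - kernelOp μ (sincKernel (Real.pi * N))
      (measurable_sincKernel _) _ (abs_sincKernel_le _))
      ((2 * Real.pi ^ 2 * W ^ 2 / (3 * Real.sin (2 * Real.pi * W))) ^ 2 * μ.real Set.univ ^ 2) := by
    rw [QTilde, kernelOp_sub μ _ _ _ _ _ _ _ _ hC'']
    refine hilbertSchmidtSqLE_kernelOp _ _ _ _ _ ?_
    filter_upwards [ae_restrict_mem measurableSet_Ioo] with x hx
    filter_upwards [ae_restrict_mem measurableSet_Ioo] with y hy
    exact abs_dirichletKernel_sub_sincKernel_le hW.2 N hx hy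
  have h := tsum_sq_sub_eigenvalueSeq_le (isPositive_QTilde hW.2.le N) hS
    (hilbertSchmidtSqLE_kernelOp _ _ _ _ _ (Filter.Eventually.of_forall fun x =>
      Filter.Eventually.of_forall (abs_dirichletKernel_le N x)))
    (hilbertSchmidtSqLE_kernelOp _ _ _ _ _ (Filter.Eventually.of_forall fun x =>
      Filter.Eventually.of_forall (abs_sincKernel_le _ x))) hD
  rw [eigenvalueSeq_kernelOp_sincKernel hW.1] at h
  simp only [lambdaTilde_eq hW.2.le, lambdaSinc]
  refine h.trans_eq ?_
  rw [hμ]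
  congr 1
  ring

end Prolate

theorem proposition1 (W : ℝ) (hW : W ∈ Set.Ioo (0 : ℝ) (1 / 2)) (N : ℕ) (hN : 1 ≤ N) :
    Summable (fun k : ℕ =>
      |Prolate.lambdaTilde W N k - Prolate.lambdaSinc (Real.pi * N * W) k| ^ 2) ∧
    Real.sqrt (∑' k : ℕ,
      |Prolate.lambdaTilde W N k - Prolate.lambdaSinc (Real.pi * N * W) k| ^ 2) ≤
      W ^ 3 * (4 * Real.pi ^ 2 / (3 * Real.sin (2 * Real.pi * W))) := by
  have h := Prolate.tsum_sq_sub_le hW N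
  simp only [← sq_abs (Prolate.lambdaTilde W N _ - _)] at h
  have hsin : 0 < Real.sin (2 * Real.pi * W) :=
    Real.sin_pos_of_pos_of_lt_pi (mul_pos Real.two_pi_pos hW.1)
      (by nlinarith [Real.pi_pos, hW.2])
  have hW0 := hW.1
  have hsum : Summable fun k : ℕ =>
      |Prolate.lambdaTilde W N k - Prolate.lambdaSinc (Real.pi * N * W) k| ^ 2 := by
    simpa only [ENNReal.toReal_ofReal (sq_nonneg _)] using
      ENNReal.summable_toReal (ne_top_of_le_ne_top ENNReal.ofReal_ne_top h)
  refine ⟨hsum, Real.sqrt_le_iff.mpr ⟨by positivity, ?_⟩⟩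
  rw [← ENNReal.ofReal_tsum_of_nonneg (fun _ => by positivity) hsum] at h
  exact (ENNReal.ofReal_le_ofReal_iff (by positivity)).mp h
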